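/- Let $\mathcal{H}$ be a finite-dimensional complex Hilbert space, $\mathcal{S}(\mathcal{H})$ the set of density operators on it, and $\mathcal{X}$ a finite alphabet. Powers of positive semi-definite operators are taken on the support, $\log$ is the natural logarithm and $0\cdot\infty=0$. For density operators $\rho,\sigma$ let $D(\rho\|\sigma)=\operatorname{Tr}[\rho(\log\rho-\log\sigma)]$ if the support of $\rho$ is contained in that of $\sigma$, and $+\infty$ otherwise; for $0<\alpha<1$ let $D_\alpha(\rho\|\sigma)=\frac1{\alpha-1}\log\lim_{\delta\downarrow0}\operatorname{Tr}[(\rho+\delta\mathbb 1)^\alpha(\sigma+\delta\mathbb 1)^{1-\alpha}]$ (with $\log 0=-\infty$), and $D_0(\rho\|\sigma)=\lim_{\alpha\downarrow0}D_\alpha(\rho\|\sigma)$. Let $\mathscr{W}:\mathcal{X}\to\mathcal{S}(\mathcal{H})$, $x\mapsto W_x$, be a classical-quantum channel. For a probability distribution $P$ on $\mathcal{X}$ and a real number $R$ define \[ E_{\mathrm{sp}}(R,P)=\sup_{s\ge0}\Big\{-\log\operatorname{Tr}\Big[\Big(\sum_{x}P(x)W_x^{1/(1+s)}\Big)^{1+s}\Big]-sR\Big\},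 \] \[ \widetilde E_{\mathrm{sp}}(R,P)=\min_{\mathscr{V}:\mathcal{X}\to\mathcal{S}(\mathcal{H})}\Big\{\sum_xP(x)D(V_x\|W_x):\ I(P,\mathscr{V})\le R\Big\},\qquad I(P,\mathscr{V})=\inf_{\sigma\in\mathcal{S}(\mathcal{H})}\sum_xP(x)D(V_x\|\sigma), \] both with values in $[-\infty,+\infty]$, and let \[ R_\infty=\sup_{P}\inf_{\sigma\in\mathcal{S}(\mathcal{H})}D_0\Big(\sum_xP(x)|x\rangle\langle x|\otimes W_x\,\Big\|\,\sum_xP(x)|x\rangle\langle x|\otimes\sigma\Big), \] where the supremum is over all probability distributions $P$ on $\mathcal{X}$. Then for every $R>R_\infty$ and every probability distribution $P$ on $\mathcal{X}$, \[ E_{\mathrm{sp}}(R,P)\le\widetilde E_{\mathrm{sp}}(R,P). \] -/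

import Mathlib

open Filter Topology
open scoped Kronecker ComplexOrder

noncomputable section

namespace CQ

/-- Density operators on the Hilbert space `ℂ^n`: positive semi-definite with unit trace. -/
def Density (n : Type*) [Fintype n] : Type _ :=
  {ρ : Matrix n n ℂ // ρ.PosSemidef ∧ ρ.trace = 1}

/-- A classical-quantum channel with input alphabet `X` and output states on `ℂ^n`. -/
abbrev Channel (X n : Type*) [Fintype n] : Type _ := X → Density n

section Operators

variable {n : Type*} [Fintype n] [DecidableEq n]

/-- Real power of a positive semi-definite matrix, taken on the support:
`A ^ p = ∑_{i : a_i ≠ 0} a_i ^ p P_i` for the spectral decomposition `A = ∑_i a_i P_i`. -/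
def mpow (A : Matrix n n ℂ) (p : ℝ) : Matrix n n ℂ :=
  cfc (fun t : ℝ => if t = 0 then 0 else t ^ p) A

/-- Natural logarithm of a positive semi-definite matrix, taken on the support. -/
def mlog (A : Matrix n n ℂ) : Matrix n n ℂ :=
  cfc (fun t : ℝ => if t = 0 then 0 else Real.log t) A

/-- The support of a Hermitian matrix, i.e. its range. -/
def supp (A : Matrix n n ℂ) : Submodule ℂ (n → ℂ) :=
  LinearMap.range A.mulVecLin

open Classical in
/-- Umegaki's relative entropy `D(ρ‖σ) = Tr[ρ (log ρ - log σ)]` if `ρ ≪ σ`, and `+∞` otherwise. -/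
def relEntropy (ρ σ : Matrix n n ℂ) : EReal :=
  if supp ρ ≤ supp σ then (((ρ * (mlog ρ - mlog σ)).trace.re : ℝ) : EReal) else ⊤

/-- `Q_α(ρ‖σ) = lim_{δ ↓ 0} Tr[(ρ + δ 1)^α (σ + δ 1)^(1 - α)]`, for `0 < α < 1`. -/
def petzQ (α : ℝ) (ρ σ : Matrix n n ℂ) : ℝ :=
  limUnder (𝓝[>] (0 : ℝ)) fun δ : ℝ =>
    (mpow (ρ + δ • (1 : Matrix n n ℂ)) α * mpow (σ + δ • (1 : Matrix n n ℂ)) (1 - α)).trace.re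

/-- Petz' Rényi divergence `D_α(ρ‖σ) = (α - 1)⁻¹ log Q_α(ρ‖σ)` for `0 < α < 1`, with
`log 0 = -∞`, so that the value is `+∞` for orthogonal supports. -/
def petzDiv (α : ℝ) (ρ σ : Matrix n n ℂ) : EReal :=
  (((α - 1)⁻¹ : ℝ) : EReal) * ENNReal.log (ENNReal.ofReal (petzQ α ρ σ))

/-- `D_0(ρ‖σ) = lim_{α ↓ 0} D_α(ρ‖σ)`. -/
def petzDivZero (ρ σ : Matrix n n ℂ) : EReal :=
  limUnder (𝓝[>] (0 : ℝ)) fun α : ℝ => petzDiv α ρ σ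

end Operators

section Channels

variable {X n : Type*} [Fintype X] [DecidableEq X] [Fintype n] [DecidableEq n]

/-- The classical-quantum state `P ∘ W = ∑_x P(x) |x⟩⟨x| ⊗ W_x`. -/
def cqState (P : X → ℝ) (W : Channel X n) : Matrix (X × n) (X × n) ℂ :=
  ∑ x, P x • (Matrix.single x x (1 : ℂ) ⊗ₖ (W x).1)

/-- The product state `P ⊗ σ`, where `P = ∑_x P(x) |x⟩⟨x|`. -/
def prodState (P : X → ℝ) (σ : Density n) : Matrix (X × n) (X × n) ℂ :=
  Matrix.diagonal (fun x => (P x : ℂ)) ⊗ₖ σ.1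

/-- The Rényi mutual information of order zero,
`I_0^{(1)}(P, W) = inf_σ D_0(P ∘ W ‖ P ⊗ σ)`. -/
def renyiInfoZero (P : X → ℝ) (W : Channel X n) : EReal :=
  ⨅ σ : Density n, petzDivZero (cqState P W) (prodState P σ)

/-- `R_∞ = C_{0,W} = sup_P I_0^{(1)}(P, W)`, the Rényi capacity of order zero. -/
def rateInfty (W : Channel X n) : EReal :=
  ⨆ P ∈ stdSimplex ℝ X, renyiInfoZero P W

/-- The conditional relative entropy `D(V‖W|P) = ∑_x P(x) D(V_x‖W_x)`, with `0 · ∞ = 0`. -/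
def condRelEntropy (V W : Channel X n) (P : X → ℝ) : EReal :=
  ∑ x, (P x : EReal) * relEntropy (V x).1 (W x).1

/-- The mutual information `I(P, V) = inf_σ D(V‖σ|P)`. -/
def mutualInfo (P : X → ℝ) (V : Channel X n) : EReal :=
  ⨅ σ : Density n, condRelEntropy V (fun _ => σ) P

/-- The auxiliary function
`E_0(s, P) = -log Tr[(∑_x P(x) W_x^{1/(1+s)})^{1+s}]`. -/
def auxE0 (W : Channel X n) (s : ℝ) (P : X → ℝ) : ℝ :=
  -Real.log (mpow (∑ x, P x • mpow (W x).1 (1 / (1 + s))) (1 + s)).trace.re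

/-- The strong sphere-packing exponent `E_sp(R, P) = sup_{s ≥ 0} (E_0(s, P) - s R)`. -/
def strongExponent (W : Channel X n) (R : ℝ) (P : X → ℝ) : EReal :=
  ⨆ s : {s : ℝ // 0 ≤ s}, ((auxE0 W s P - s * R : ℝ) : EReal)

/-- The weak sphere-packing exponent: the minimum of `D(V‖W|P)` over all channels `V` with
`I(P, V) ≤ R`. -/
def weakExponent (W : Channel X n) (R : ℝ) (P : X → ℝ) : EReal :=
  ⨅ V : {V : Channel X n // mutualInfo P V ≤ (R : EReal)}, condRelEntropy V.1 W P

end Channels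

end CQ

end

/-! Each `s ≥ 0` and each admissible `V` can be treated separately: it suffices that `E_0(s, P) ≤
D(V‖W|P) + s D(V‖σ|P)` for every `σ` (`neg_log_trace_mpow_le`). Taking the infimum over `σ` then
turns the last term into at most `sR`.

Put `B_x = W_x^{1/(1+s)}`, `A = ∑ P(x) B_x`, `V̄ = ∑ P(x) V_x`. Gibbs' inequality for `A^{1+s}`
bounds `E_0` by `(1+s) D(V̄‖A) - s Tr V̄ log V̄`. Joint convexity gives `D(V̄‖A) ≤ ∑ P(x)
D(V_x‖B_x)`, and the factor `1+s` undoes the power in `B_x`. What remains is `D(V‖W|P)` plus `s`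
times `∑ P(x) D(V_x‖σ) - D(V̄‖σ)`, where `D(V̄‖σ) ≥ 0` by Gibbs again.

Joint convexity (`relEnt_sum_le`) comes from the quasi-entropies `⟨V, (t R_V + L_B)⁻¹ V⟩`: each is a
maximum of functionals linear in `(V, B)`, hence jointly convex. Their integral over `[0, T]`, minus
`log T · Tr V`, tends to the relative entropy. -/

noncomputable section

namespace CQ

open Matrix

/-! ### Spectral calculus for pairs of Hermitian matrices. -/

section Spectral

variable {n : Type*} [Fintype n] [DecidableEq n]

/-- The unitary change of basis between the eigenbases of two Hermitian matrices. -/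
def transition {A B : Matrix n n ℂ} (hA : A.IsHermitian) (hB : B.IsHermitian) : Matrix n n ℂ :=
  star (hA.eigenvectorUnitary : Matrix n n ℂ) * (hB.eigenvectorUnitary : Matrix n n ℂ)

/-- The squared moduli of the inner products of the eigenvectors of two Hermitian matrices. -/
def overlap {A B : Matrix n n ℂ} (hA : A.IsHermitian) (hB : B.IsHermitian) (i j : n) : ℝ :=
  Complex.normSq (transition hA hB i j)

theorem overlap_nonneg {A B : Matrix n n ℂ} (hA : A.IsHermitian) (hB : B.IsHermitian) (i j : n) :
    0 ≤ overlap hA hB i j :=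
  Complex.normSq_nonneg _

theorem trace_diagonal_mul_mul_diagonal_mul (d e : n → ℂ) (Z Y : Matrix n n ℂ) :
    (diagonal d * Z * diagonal e * Y).trace = ∑ i, ∑ j, d i * Z i j * e j * Y j i := by
  simp [Matrix.trace, Matrix.mul_apply, Matrix.diagonal_apply]

theorem cfc_eq_conj {A : Matrix n n ℂ} (hA : A.IsHermitian) (f : ℝ → ℝ) :
    cfc f A = (hA.eigenvectorUnitary : Matrix n n ℂ) *
      diagonal (fun i => ((f (hA.eigenvalues i) : ℝ) : ℂ)) *
      star (hA.eigenvectorUnitary : Matrix n n ℂ) := by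
  rw [hA.cfc_eq, Matrix.IsHermitian.cfc, Unitary.conjStarAlgAut_apply]
  rfl

theorem eq_conj {A : Matrix n n ℂ} (hA : A.IsHermitian) :
    A = (hA.eigenvectorUnitary : Matrix n n ℂ) *
      diagonal (fun i => ((hA.eigenvalues i : ℝ) : ℂ)) *
      star (hA.eigenvectorUnitary : Matrix n n ℂ) := by
  rw [← cfc_eq_conj hA (fun t => t), cfc_id' ℝ A hA.isSelfAdjoint]

theorem star_eigenvectorUnitary_mul {A : Matrix n n ℂ} (hA : A.IsHermitian) (M : Matrix n n ℂ) :
    star (hA.eigenvectorUnitary : Matrix n n ℂ) *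
      ((hA.eigenvectorUnitary : Matrix n n ℂ) * M) = M := by
  rw [← mul_assoc, Unitary.coe_star_mul_self, one_mul]

theorem eigenvectorUnitary_mul_star {A : Matrix n n ℂ} (hA : A.IsHermitian) (M : Matrix n n ℂ) :
    (hA.eigenvectorUnitary : Matrix n n ℂ) *
      (star (hA.eigenvectorUnitary : Matrix n n ℂ) * M) = M := by
  rw [← mul_assoc, Unitary.mul_star_self_of_mem hA.eigenvectorUnitary.2, one_mul]

theorem mul_eigenvectorUnitary {A : Matrix n n ℂ} (hA : A.IsHermitian) (M : Matrix n n ℂ) :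
    A * ((hA.eigenvectorUnitary : Matrix n n ℂ) * M) = (hA.eigenvectorUnitary : Matrix n n ℂ) *
      (diagonal (fun i => ((hA.eigenvalues i : ℝ) : ℂ)) * M) := by
  have h := congrArg (· * ((hA.eigenvectorUnitary : Matrix n n ℂ) * M)) (eq_conj hA)
  simpa only [mul_assoc, star_eigenvectorUnitary_mul] using h

/-- The trace of a product of functions of two Hermitian matrices, in terms of the spectral data. -/
theorem re_trace_cfc_mul_cfc {A B : Matrix n n ℂ} (hA : A.IsHermitian) (hB : B.IsHermitian)
    (f g : ℝ → ℝ) :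
    (cfc f A * cfc g B).trace.re =
      ∑ i, ∑ j, overlap hA hB i j * (f (hA.eigenvalues i) * g (hB.eigenvalues j)) := by
  have h : (cfc f A * cfc g B).trace =
      (diagonal (fun i => ((f (hA.eigenvalues i) : ℝ) : ℂ)) * transition hA hB *
        diagonal (fun i => ((g (hB.eigenvalues i) : ℝ) : ℂ)) * star (transition hA hB)).trace := by
    rw [cfc_eq_conj hA, cfc_eq_conj hB, transition, star_mul, star_star]
    simp only [mul_assoc]
    rw [Matrix.trace_mul_comm]
    simp only [mul_assoc]
  rw [h, trace_diagonal_mul_mul_diagonal_mul, Complex.re_sum]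
  refine Finset.sum_congr rfl fun i _ => ?_
  rw [Complex.re_sum]
  refine Finset.sum_congr rfl fun j _ => ?_
  have : (f (hA.eigenvalues i) : ℂ) * transition hA hB i j * (g (hB.eigenvalues j) : ℂ) *
      (star (transition hA hB)) j i =
      ((overlap hA hB i j * (f (hA.eigenvalues i) * g (hB.eigenvalues j)) : ℝ) : ℂ) := by
    rw [Matrix.star_apply, overlap, Complex.ofReal_mul, Complex.normSq_eq_conj_mul_self]
    push_cast
    simp only [Complex.star_def]
    ring
  rw [this, Complex.ofReal_re]

/-- The transition matrix is unitary; with `sum_overlap_left` this makes the overlaps doubly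
stochastic, so traces become classical double sums. -/
theorem sum_overlap_right {A B : Matrix n n ℂ} (hA : A.IsHermitian) (hB : B.IsHermitian) (i : n) :
    ∑ j, overlap hA hB i j = 1 := by
  have h : transition hA hB * star (transition hA hB) = 1 := by
    rw [transition, star_mul, star_star, mul_assoc, eigenvectorUnitary_mul_star,
      Unitary.coe_star_mul_self]
  have h' := congr_fun (congr_fun h i) i
  rw [Matrix.mul_apply, Matrix.one_apply_eq] at h'
  rw [← Complex.ofReal_inj, Complex.ofReal_sum, Complex.ofReal_one, ← h']
  refine Finset.sum_congr rfl fun j _ => ?_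
  rw [overlap, Complex.normSq_eq_conj_mul_self, Matrix.star_apply, mul_comm]
  rfl

theorem sum_overlap_left {A B : Matrix n n ℂ} (hA : A.IsHermitian) (hB : B.IsHermitian) (j : n) :
    ∑ i, overlap hA hB i j = 1 := by
  have h : star (transition hA hB) * transition hA hB = 1 := by
    rw [transition, star_mul, star_star, mul_assoc, eigenvectorUnitary_mul_star,
      Unitary.coe_star_mul_self]
  have h' := congr_fun (congr_fun h j) j
  rw [Matrix.mul_apply, Matrix.one_apply_eq] at h'
  rw [← Complex.ofReal_inj, Complex.ofReal_sum, Complex.ofReal_one, ← h']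
  refine Finset.sum_congr rfl fun i _ => ?_
  rw [overlap, Complex.normSq_eq_conj_mul_self, Matrix.star_apply]
  rfl

theorem re_trace_cfc {A : Matrix n n ℂ} (hA : A.IsHermitian) (f : ℝ → ℝ) :
    (cfc f A).trace.re = ∑ i, f (hA.eigenvalues i) := by
  rw [cfc_eq_conj hA, Matrix.trace_mul_comm, star_eigenvectorUnitary_mul, Matrix.trace_diagonal,
    Complex.re_sum]
  simp

/-- If the kernel of `B` lies in that of `A`, then eigenvectors of `A` with non-zero eigenvalue are
orthogonal to the kernel of `B`. -/
theorem overlap_mul_eigenvalue_eq_zero {A B : Matrix n n ℂ} (hA : A.IsHermitian)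
    (hB : B.IsHermitian) (h : ∀ v, B *ᵥ v = 0 → A *ᵥ v = 0) {i j : n}
    (hj : hB.eigenvalues j = 0) : overlap hA hB i j * hA.eigenvalues i = 0 := by
  have h1 : A *ᵥ ⇑(hB.eigenvectorBasis j) = 0 := by
    apply h
    rw [hB.mulVec_eigenvectorBasis, hj, zero_smul]
  have h2 : (diagonal (fun i => ((hA.eigenvalues i : ℝ) : ℂ)) * transition hA hB) =
      star (hA.eigenvectorUnitary : Matrix n n ℂ) * (A * (hB.eigenvectorUnitary : Matrix n n ℂ)) := by
    rw [← eigenvectorUnitary_mul_star hA (hB.eigenvectorUnitary : Matrix n n ℂ),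
      mul_eigenvectorUnitary, star_eigenvectorUnitary_mul, transition]
  have h3 : ∀ k, (A * (hB.eigenvectorUnitary : Matrix n n ℂ)) k j = 0 := fun k => congr_fun h1 k
  have h4 := congr_fun (congr_fun h2 i) j
  rw [Matrix.diagonal_mul, Matrix.mul_apply] at h4
  simp only [h3, mul_zero, Finset.sum_const_zero, mul_eq_zero, Complex.ofReal_eq_zero] at h4
  rcases h4 with h4 | h4
  · rw [h4, mul_zero]
  · rw [overlap, h4, map_zero, zero_mul]

/-! ### Quasi-entropies and their joint convexity. -/

/-- The quasi-entropy `⟨V, (t R_V + L_B)⁻¹ V⟩` in terms of the spectral data of `V` and `B`. -/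
def quasiEntropy (t : ℝ) {V B : Matrix n n ℂ} (hV : V.IsHermitian) (hB : B.IsHermitian) : ℝ :=
  ∑ i, ∑ j, overlap hV hB i j *
    (hV.eigenvalues i ^ 2 / (hB.eigenvalues j + t * hV.eigenvalues i))

/-- The functional, linear in `(V, B)`, whose supremum over `Y` is the quasi-entropy. -/
def quasiFunctional (t : ℝ) (Y V B : Matrix n n ℂ) : ℝ :=
  2 * (V * Y).trace.re - (Y * B * star Y).trace.re - t * (star Y * V * Y).trace.re

/-- In the mixed eigenbases of `V` and `B` the functional decouples into scalar quadratics, one for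
each entry of `K`. -/
theorem quasiFunctional_conj (t : ℝ) {V B : Matrix n n ℂ} (hV : V.IsHermitian)
    (hB : B.IsHermitian) (K : Matrix n n ℂ) :
    quasiFunctional t ((hV.eigenvectorUnitary : Matrix n n ℂ) * K *
      star (hB.eigenvectorUnitary : Matrix n n ℂ)) V B =
    ∑ i, ∑ j, (2 * (hV.eigenvalues i * (K i j * star (transition hV hB i j)).re) -
      (hB.eigenvalues j + t * hV.eigenvalues i) * Complex.normSq (K i j)) := by
  have h1 : (V * ((hV.eigenvectorUnitary : Matrix n n ℂ) * K *
      star (hB.eigenvectorUnitary : Matrix n n ℂ))).trace =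
      (diagonal (fun i => ((hV.eigenvalues i : ℝ) : ℂ)) * K * diagonal (fun _ => 1) *
        star (transition hV hB)).trace := by
    rw [diagonal_one, mul_one, transition, star_mul, star_star]
    simp only [mul_assoc, mul_eigenvectorUnitary]
    rw [Matrix.trace_mul_comm]
    simp only [mul_assoc]
  have h2 : ((hV.eigenvectorUnitary : Matrix n n ℂ) * K *
      star (hB.eigenvectorUnitary : Matrix n n ℂ) * B *
      star ((hV.eigenvectorUnitary : Matrix n n ℂ) * K *
      star (hB.eigenvectorUnitary : Matrix n n ℂ))).trace =
      (diagonal (fun _ => 1) * K * diagonal (fun i => ((hB.eigenvalues i : ℝ) : ℂ)) *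
        star K).trace := by
    simp only [diagonal_one, one_mul, star_mul, star_star, mul_assoc, star_eigenvectorUnitary_mul,
      mul_eigenvectorUnitary]
    rw [Matrix.trace_mul_comm]
    simp only [mul_assoc, Unitary.coe_star_mul_self, mul_one]
  have h3 : (star ((hV.eigenvectorUnitary : Matrix n n ℂ) * K *
      star (hB.eigenvectorUnitary : Matrix n n ℂ)) * V *
      ((hV.eigenvectorUnitary : Matrix n n ℂ) * K *
      star (hB.eigenvectorUnitary : Matrix n n ℂ))).trace =
      (diagonal (fun i => ((hV.eigenvalues i : ℝ) : ℂ)) * K * diagonal (fun _ => 1) *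
        star K).trace := by
    simp only [diagonal_one, mul_one, star_mul, star_star, mul_assoc, star_eigenvectorUnitary_mul,
      mul_eigenvectorUnitary]
    rw [Matrix.trace_mul_comm]
    simp only [mul_assoc, Unitary.coe_star_mul_self, mul_one]
    rw [Matrix.trace_mul_comm]
    simp only [mul_assoc]
  rw [quasiFunctional, h1, h2, h3]
  simp only [trace_diagonal_mul_mul_diagonal_mul, Complex.re_sum, Finset.mul_sum,
    ← Finset.sum_sub_distrib]
  refine Finset.sum_congr rfl fun i _ => Finset.sum_congr rfl fun j _ => ?_
  simp only [Matrix.star_apply, Complex.star_def, Complex.mul_re, Complex.mul_im, Complex.conj_re,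
    Complex.conj_im, Complex.ofReal_re, Complex.ofReal_im, Complex.one_re, Complex.one_im,
    Complex.normSq_apply]
  ring

theorem quasiFunctional_le {t : ℝ} (ht : 0 < t) {V B : Matrix n n ℂ} (hV : V.PosSemidef)
    (hB : B.PosSemidef) (Y : Matrix n n ℂ) :
    quasiFunctional t Y V B ≤ quasiEntropy t hV.1 hB.1 := by
  have hY : Y = (hV.1.eigenvectorUnitary : Matrix n n ℂ) *
      (star (hV.1.eigenvectorUnitary : Matrix n n ℂ) * Y *
        (hB.1.eigenvectorUnitary : Matrix n n ℂ)) *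
      star (hB.1.eigenvectorUnitary : Matrix n n ℂ) := by
    simp only [mul_assoc, eigenvectorUnitary_mul_star,
      Unitary.mul_star_self_of_mem hB.1.eigenvectorUnitary.2, mul_one]
  rw [hY, quasiFunctional_conj, quasiEntropy]
  refine Finset.sum_le_sum fun i _ => Finset.sum_le_sum fun j _ => ?_
  generalize (star (hV.1.eigenvectorUnitary : Matrix n n ℂ) * Y *
        (hB.1.eigenvectorUnitary : Matrix n n ℂ)) i j = k
  have hl := hV.eigenvalues_nonneg i
  have hm := hB.eigenvalues_nonneg j
  rw [overlap]
  generalize transition hV.1 hB.1 i j = z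
  generalize hV.1.eigenvalues i = l at *
  generalize hB.1.eigenvalues j = m at *
  -- At `l = 0` the denominator may vanish, but so does `l ^ 2`, so the quotient is `0` in every
  -- case.
  rcases hl.eq_or_lt with rfl | hl
  · have := mul_nonneg hm (Complex.normSq_nonneg k)
    simp
    exact this
  have hc : 0 < m + t * l := by positivity
  generalize m + t * l = c at *
  rw [mul_div_assoc', le_div_iff₀ hc]
  simp only [Complex.star_def, Complex.mul_re, Complex.conj_re, Complex.conj_im,
    Complex.normSq_apply]
  -- Completing the square: `|l z - c k|² ≥ 0`, with equality at `k = l z / c`, the maximiser used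
  -- in `exists_quasiFunctional_eq`.
  nlinarith [sq_nonneg (l * z.re - c * k.re), sq_nonneg (l * z.im - c * k.im)]

theorem exists_quasiFunctional_eq {t : ℝ} (ht : 0 < t) {V B : Matrix n n ℂ} (hV : V.PosSemidef)
    (hB : B.PosSemidef) :
    ∃ Y, quasiFunctional t Y V B = quasiEntropy t hV.1 hB.1 := by
  refine ⟨_, (quasiFunctional_conj t hV.1 hB.1 (Matrix.of fun i j =>
    ((hV.1.eigenvalues i / (hB.1.eigenvalues j + t * hV.1.eigenvalues i) : ℝ) : ℂ) *
      transition hV.1 hB.1 i j)).trans ?_⟩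
  rw [quasiEntropy]
  refine Finset.sum_congr rfl fun i _ => Finset.sum_congr rfl fun j _ => ?_
  rw [Matrix.of_apply, overlap]
  have hl := hV.eigenvalues_nonneg i
  have hm := hB.eigenvalues_nonneg j
  generalize transition hV.1 hB.1 i j = z
  generalize hV.1.eigenvalues i = l at *
  generalize hB.1.eigenvalues j = m at *
  rcases hl.eq_or_lt with rfl | hl
  · simp
  have hc : 0 < m + t * l := by positivity
  generalize m + t * l = c at *
  simp only [Complex.star_def, Complex.mul_re, Complex.mul_im, Complex.conj_re, Complex.conj_im,
    Complex.normSq_apply, Complex.ofReal_re, Complex.ofReal_im]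
  field_simp
  ring

theorem quasiFunctional_sum {X : Type*} [Fintype X] (t : ℝ) (Y : Matrix n n ℂ) (p : X → ℝ)
    (V B : X → Matrix n n ℂ) :
    quasiFunctional t Y (∑ x, p x • V x) (∑ x, p x • B x) =
      ∑ x, p x * quasiFunctional t Y (V x) (B x) := by
  simp only [quasiFunctional, Finset.sum_mul, Finset.mul_sum, Matrix.trace_sum, Complex.re_sum,
    smul_mul_assoc, mul_smul_comm, Matrix.trace_smul, Complex.smul_re, smul_eq_mul,
    ← Finset.sum_sub_distrib]
  exact Finset.sum_congr rfl fun x _ => by ring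

/-- Joint convexity of the quasi-entropy. -/
theorem quasiEntropy_sum_le {X : Type*} [Fintype X] {t : ℝ} (ht : 0 < t) {p : X → ℝ}
    (hp : ∀ x, 0 ≤ p x) {V B : X → Matrix n n ℂ} (hV : ∀ x, (V x).PosSemidef)
    (hB : ∀ x, (B x).PosSemidef) (hVs : (∑ x, p x • V x).PosSemidef)
    (hBs : (∑ x, p x • B x).PosSemidef) :
    quasiEntropy t hVs.1 hBs.1 ≤ ∑ x, p x * quasiEntropy t (hV x).1 (hB x).1 := by
  -- The optimal `Y` for the averaged pair is a competitor for every single pair.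
  obtain ⟨Y, hY⟩ := exists_quasiFunctional_eq ht hVs hBs
  rw [← hY, quasiFunctional_sum]
  exact Finset.sum_le_sum fun x _ =>
    mul_le_mul_of_nonneg_left (quasiFunctional_le ht (hV x) (hB x) Y) (hp x)

/-! ### Powers, logarithms and kernels. -/

theorem mlog_eq_cfc (A : Matrix n n ℂ) : mlog A = cfc Real.log A := by
  rw [mlog]
  congr 1
  funext t
  split_ifs with h <;> simp [h]

theorem mpow_eq_cfc (A : Matrix n n ℂ) {p : ℝ} (hp : p ≠ 0) :
    mpow A p = cfc (fun t : ℝ => t ^ p) A := by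
  rw [mpow]
  congr 1
  funext t
  split_ifs with h <;> simp [h, Real.zero_rpow hp]

theorem continuousOn_image_spectrum (A : Matrix n n ℂ) (f g : ℝ → ℝ) :
    ContinuousOn g (f '' spectrum ℝ A) :=
  (A.finite_real_spectrum.image f).continuousOn g

theorem continuousOn_spectrum (A : Matrix n n ℂ) (g : ℝ → ℝ) : ContinuousOn g (spectrum ℝ A) :=
  A.finite_real_spectrum.continuousOn g

theorem nonneg_of_mem_spectrum {A : Matrix n n ℂ} (hA : A.PosSemidef) {t : ℝ}
    (ht : t ∈ spectrum ℝ A) : 0 ≤ t := by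
  rw [hA.1.spectrum_real_eq_range_eigenvalues] at ht
  obtain ⟨i, rfl⟩ := ht
  exact hA.eigenvalues_nonneg i

theorem mpow_posSemidef {A : Matrix n n ℂ} (hA : A.PosSemidef) {p : ℝ} (hp : p ≠ 0) :
    (mpow A p).PosSemidef := by
  rw [mpow_eq_cfc A hp, cfc_eq_conj hA.1]
  refine PosSemidef.mul_mul_conjTranspose_same (PosSemidef.diagonal fun i => ?_) _
  exact Complex.zero_le_real.2 (Real.rpow_nonneg (hA.eigenvalues_nonneg i) p)

theorem mlog_mpow {A : Matrix n n ℂ} (hA : A.PosSemidef) {p : ℝ} (hp : p ≠ 0) :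
    mlog (mpow A p) = p • mlog A := by
  rw [mlog_eq_cfc, mlog_eq_cfc, mpow_eq_cfc A hp,
    ← cfc_comp' Real.log (fun t : ℝ => t ^ p) A (continuousOn_image_spectrum A _ _)
      (continuousOn_spectrum A _) hA.1.isSelfAdjoint,
    ← cfc_const_mul p Real.log A (continuousOn_spectrum A _)]
  refine cfc_congr fun t ht => ?_
  rcases (nonneg_of_mem_spectrum hA ht).eq_or_lt with rfl | h
  · simp [Real.zero_rpow hp]
  · exact Real.log_rpow h p

theorem mulVec_eq_zero_of_mpow_mulVec_eq_zero {A : Matrix n n ℂ} (hA : A.PosSemidef) {p : ℝ}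
    (hp : p ≠ 0) {v : n → ℂ} (hv : mpow A p *ᵥ v = 0) : A *ᵥ v = 0 := by
  have h : A = cfc (fun t : ℝ => t ^ (1 - p)) A * mpow A p := by
    rw [mpow_eq_cfc A hp, ← cfc_mul _ _ A (continuousOn_spectrum A _) (continuousOn_spectrum A _)]
    conv_lhs => rw [← cfc_id' ℝ A hA.1.isSelfAdjoint]
    refine cfc_congr fun t ht => ?_
    rcases (nonneg_of_mem_spectrum hA ht).eq_or_lt with rfl | h
    · simp [Real.zero_rpow hp]
    · rw [← Real.rpow_add h, sub_add_cancel, Real.rpow_one]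
  rw [h, ← Matrix.mulVec_mulVec, hv, Matrix.mulVec_zero]

/-- Writing `A (A v) = B u`, one gets `‖A v‖² = ⟨v, B u⟩ = ⟨B v, u⟩ = 0`. -/
theorem mulVec_eq_zero_of_supp_le {m : Type*} [Fintype m] {A B : Matrix m m ℂ}
    (hA : A.IsHermitian) (hB : B.IsHermitian) (h : supp A ≤ supp B) {v : m → ℂ}
    (hv : B *ᵥ v = 0) : A *ᵥ v = 0 := by
  obtain ⟨u, hu⟩ := h (LinearMap.mem_range_self A.mulVecLin (A *ᵥ v))
  simp only [Matrix.mulVecLin_apply] at hu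
  have h1 : star (A *ᵥ v) ⬝ᵥ (A *ᵥ v) = 0 := by
    rw [Matrix.star_mulVec, hA.eq, ← Matrix.dotProduct_mulVec, ← hu, Matrix.dotProduct_mulVec,
      ← hB.eq, ← Matrix.star_mulVec, hv, star_zero, zero_dotProduct]
  exact dotProduct_star_self_eq_zero.1 h1

theorem re_trace_eq_sum_eigenvalues {A : Matrix n n ℂ} (hA : A.IsHermitian) :
    A.trace.re = ∑ i, hA.eigenvalues i := by
  rw [← re_trace_cfc hA (fun t => t), cfc_id' ℝ A hA.isSelfAdjoint]

/-! ### Relative entropy and Gibbs' inequality. -/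

/-- The value `Tr[V (log V - log B)]`. -/
def relEnt (V B : Matrix n n ℂ) : ℝ := (V * (mlog V - mlog B)).trace.re

theorem relEnt_eq_sub (V B : Matrix n n ℂ) :
    relEnt V B = (V * mlog V).trace.re - (V * mlog B).trace.re := by
  rw [relEnt, mul_sub, Matrix.trace_sub, Complex.sub_re]

theorem relEnt_eq_sum {V B : Matrix n n ℂ} (hV : V.IsHermitian) (hB : B.IsHermitian) :
    relEnt V B = ∑ i, ∑ j, overlap hV hB i j * hV.eigenvalues i *
      (Real.log (hV.eigenvalues i) - Real.log (hB.eigenvalues j)) := by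
  have h1 : (V * mlog V).trace.re = ∑ i, ∑ j, overlap hV hB i j *
      (hV.eigenvalues i * Real.log (hV.eigenvalues i)) := by
    have h : V * mlog V = cfc (fun t : ℝ => t * Real.log t) V := by
      rw [cfc_mul (fun t : ℝ => t) Real.log V (continuousOn_spectrum V _)
        (continuousOn_spectrum V _), cfc_id' ℝ V hV.isSelfAdjoint, mlog_eq_cfc]
    rw [h, re_trace_cfc hV]
    refine Finset.sum_congr rfl fun i _ => ?_
    rw [← Finset.sum_mul, sum_overlap_right, one_mul]
  have h2 : (V * mlog B).trace.re = ∑ i, ∑ j, overlap hV hB i j *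
      (hV.eigenvalues i * Real.log (hB.eigenvalues j)) := by
    rw [← re_trace_cfc_mul_cfc hV hB (fun t => t), cfc_id' ℝ V hV.isSelfAdjoint, mlog_eq_cfc]
  rw [relEnt_eq_sub, h1, h2, ← Finset.sum_sub_distrib]
  refine Finset.sum_congr rfl fun i _ => ?_
  rw [← Finset.sum_sub_distrib]
  exact Finset.sum_congr rfl fun j _ => by ring

/-- **Gibbs' variational inequality** `Tr[V (log V - log C)] ≥ -log Tr C`. -/
theorem neg_log_trace_le_relEnt {V C : Matrix n n ℂ} (hV : V.PosSemidef) (hVt : V.trace = 1)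
    (hC : C.PosSemidef) (h : ∀ v, C *ᵥ v = 0 → V *ᵥ v = 0) :
    -Real.log C.trace.re ≤ relEnt V C := by
  have hl : ∑ i, hV.1.eigenvalues i = 1 := by
    rw [← re_trace_eq_sum_eigenvalues, hVt, Complex.one_re]
  -- If the trace vanished, so would all eigenvalues of `C`; the kernel condition would then give `V
  -- = 0`, against unit trace.
  have hZ : 0 < C.trace.re := by
    rw [re_trace_eq_sum_eigenvalues hC.1]
    refine (Finset.sum_nonneg fun i _ => hC.eigenvalues_nonneg i).lt_of_ne fun h0 => ?_
    have h1 := (Finset.sum_eq_zero_iff_of_nonneg fun i _ => hC.eigenvalues_nonneg i).1 h0.symm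
    have h2 : ∀ i, hV.1.eigenvalues i = 0 := fun i => by
      rw [← one_mul (hV.1.eigenvalues i), ← sum_overlap_right hV.1 hC.1 i, Finset.sum_mul]
      exact Finset.sum_eq_zero fun j hj =>
        overlap_mul_eigenvalue_eq_zero hV.1 hC.1 h (h1 j hj)
    simp [h2] at hl
  set Z := C.trace.re with hZdef
  have key : ∑ i, ∑ j, overlap hV.1 hC.1 i j * (hV.1.eigenvalues i - hC.1.eigenvalues j / Z) ≤
      ∑ i, ∑ j, (overlap hV.1 hC.1 i j * hV.1.eigenvalues i *
        (Real.log (hV.1.eigenvalues i) - Real.log (hC.1.eigenvalues j)) +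
        overlap hV.1 hC.1 i j * hV.1.eigenvalues i * Real.log Z) := by
    refine Finset.sum_le_sum fun i _ => Finset.sum_le_sum fun j _ => ?_
    have hw := overlap_nonneg hV.1 hC.1 i j
    have h0 := overlap_mul_eigenvalue_eq_zero (i := i) (j := j) hV.1 hC.1 h
    have hli := hV.eigenvalues_nonneg i
    have hmj := hC.eigenvalues_nonneg j
    generalize overlap hV.1 hC.1 i j = w at *
    generalize hV.1.eigenvalues i = l at *
    generalize hC.1.eigenvalues j = m at *
    rcases hli.eq_or_lt with rfl | hlp
    · have : 0 ≤ w * (m / Z) := by positivity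
      simpa using this
    rcases hmj.eq_or_lt with rfl | hmp
    · have : w = 0 := by simpa [hlp.ne'] using h0 rfl
      simp [this]
    · have h3 := Real.one_sub_inv_le_log_of_pos (show 0 < l * Z / m by positivity)
      rw [Real.log_div (by positivity) hmp.ne', Real.log_mul hlp.ne' hZ.ne'] at h3
      have h4 := mul_le_mul_of_nonneg_left h3 (mul_nonneg hw hli)
      have h5 : w * l * (1 - (l * Z / m)⁻¹) = w * (l - m / Z) := by
        field_simp
      linarith
  have e1 : ∑ i, ∑ j, overlap hV.1 hC.1 i j * (hV.1.eigenvalues i - hC.1.eigenvalues j / Z) =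
      0 := by
    simp only [mul_sub, Finset.sum_sub_distrib, ← Finset.sum_mul, sum_overlap_right, one_mul, hl]
    rw [Finset.sum_comm]
    simp only [← Finset.sum_mul, sum_overlap_left, one_mul, ← Finset.sum_div]
    rw [← re_trace_eq_sum_eigenvalues hC.1, ← hZdef, div_self hZ.ne', sub_self]
  have e2 : ∑ i, ∑ j, overlap hV.1 hC.1 i j * hV.1.eigenvalues i * Real.log Z = Real.log Z := by
    simp only [← Finset.sum_mul, sum_overlap_right, one_mul, hl]
  simp only [Finset.sum_add_distrib] at key
  rw [e1, e2, ← relEnt_eq_sum] at key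
  linarith

/-! ### Integral representation and joint convexity of relative entropy. -/

/-- The integral of the quasi-entropy over `[0, T]`. -/
def integratedEntropy (T : ℝ) {V B : Matrix n n ℂ} (hV : V.IsHermitian) (hB : B.IsHermitian) : ℝ :=
  ∑ i, ∑ j, overlap hV hB i j * hV.eigenvalues i *
    (Real.log (hB.eigenvalues j + T * hV.eigenvalues i) - Real.log (hB.eigenvalues j))

theorem integratedEntropy_zero {V B : Matrix n n ℂ} (hV : V.IsHermitian) (hB : B.IsHermitian) :
    integratedEntropy 0 hV hB = 0 := by
  simp [integratedEntropy]

theorem hasDerivAt_integratedEntropy {V B : Matrix n n ℂ} (hV : V.PosSemidef) (hB : B.PosSemidef)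
    (h : ∀ v, B *ᵥ v = 0 → V *ᵥ v = 0) {T : ℝ} (hT : 0 ≤ T) :
    HasDerivAt (fun T => integratedEntropy T hV.1 hB.1) (quasiEntropy T hV.1 hB.1) T := by
  unfold integratedEntropy quasiEntropy
  refine HasDerivAt.fun_sum fun i _ => HasDerivAt.fun_sum fun j _ => ?_
  have h0 := overlap_mul_eigenvalue_eq_zero (i := i) (j := j) hV.1 hB.1 h
  have hl := hV.eigenvalues_nonneg i
  have hm := hB.eigenvalues_nonneg j
  generalize overlap hV.1 hB.1 i j = w at *
  generalize hV.1.eigenvalues i = l at *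
  generalize hB.1.eigenvalues j = m at *
  rcases eq_or_ne (w * l) 0 with hwl | hwl
  · have : w * (l ^ 2 / (m + T * l)) = 0 := by
      rw [mul_div_assoc', pow_two, ← mul_assoc, hwl, zero_mul, zero_div]
    simpa only [hwl, zero_mul, this] using hasDerivAt_const T (0 : ℝ)
  -- The kernel condition excludes `m = 0` in every term of nonzero weight, so the logarithm is
  -- differentiable even at `T = 0`.
  · have hmp : 0 < m := hm.lt_of_ne fun e => hwl (h0 e.symm)
    have hc : 0 < m + T * l := by positivity
    have h1 : HasDerivAt (fun T => m + T * l) l T := by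
      simpa using ((hasDerivAt_id T).mul_const l).const_add m
    have h2 := ((h1.log hc.ne').sub_const (Real.log m)).const_mul (w * l)
    exact h2.congr_deriv (by ring)

theorem tendsto_integratedEntropy {V B : Matrix n n ℂ} (hV : V.PosSemidef) (hB : B.PosSemidef) :
    Tendsto (fun T => integratedEntropy T hV.1 hB.1 - Real.log T * V.trace.re) atTop
      (𝓝 (relEnt V B)) := by
  have e : ∀ T, integratedEntropy T hV.1 hB.1 - Real.log T * V.trace.re =
      ∑ i, ∑ j, overlap hV.1 hB.1 i j * hV.1.eigenvalues i *
        (Real.log (hB.1.eigenvalues j + T * hV.1.eigenvalues i) - Real.log T -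
          Real.log (hB.1.eigenvalues j)) := fun T => by
    have : Real.log T * V.trace.re =
        ∑ i, ∑ j, overlap hV.1 hB.1 i j * (hV.1.eigenvalues i * Real.log T) := by
      simp only [← Finset.sum_mul, sum_overlap_right, one_mul]
      rw [re_trace_eq_sum_eigenvalues hV.1, mul_comm]
    rw [this, integratedEntropy]
    simp only [← Finset.sum_sub_distrib]
    exact Finset.sum_congr rfl fun i _ => Finset.sum_congr rfl fun j _ => by ring
  simp only [e]
  rw [relEnt_eq_sum hV.1 hB.1]
  refine tendsto_finsetSum _ fun i _ => tendsto_finsetSum _ fun j _ => ?_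
  have hl := hV.eigenvalues_nonneg i
  have hm := hB.eigenvalues_nonneg j
  generalize overlap hV.1 hB.1 i j = w at *
  generalize hV.1.eigenvalues i = l at *
  generalize hB.1.eigenvalues j = m at *
  rcases hl.eq_or_lt with rfl | hlp
  · simp
  refine Tendsto.const_mul _ (Tendsto.sub_const ?_ _)
  have h1 : Tendsto (fun T : ℝ => m / T + l) atTop (𝓝 l) := by
    simpa using (tendsto_id.const_div_atTop m).add_const l
  refine ((Real.continuousAt_log hlp.ne').tendsto.comp h1).congr' ?_
  filter_upwards [eventually_gt_atTop 0] with T hT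
  rw [← Real.log_div (by positivity) hT.ne', Function.comp_apply]
  congr 1
  field_simp

/-- Joint convexity of the relative entropy of positive semi-definite matrices. -/
theorem relEnt_sum_le {X : Type*} [Fintype X] {p : X → ℝ} (hp : ∀ x, 0 ≤ p x)
    {V B : X → Matrix n n ℂ} (hV : ∀ x, (V x).PosSemidef) (hB : ∀ x, (B x).PosSemidef)
    (hVs : (∑ x, p x • V x).PosSemidef) (hBs : (∑ x, p x • B x).PosSemidef)
    (h : ∀ x, p x ≠ 0 → ∀ v, B x *ᵥ v = 0 → V x *ᵥ v = 0)
    (hs : ∀ v, (∑ x, p x • B x) *ᵥ v = 0 → (∑ x, p x • V x) *ᵥ v = 0) :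
    relEnt (∑ x, p x • V x) (∑ x, p x • B x) ≤ ∑ x, p x * relEnt (V x) (B x) := by
  -- `φ` is the integrated convexity gap: zero at `0`, with nonnegative derivative. The `log T`
  -- corrections cancel in it because the trace is linear.
  set φ : ℝ → ℝ := fun T => ∑ x, p x * integratedEntropy T (hV x).1 (hB x).1 -
    integratedEntropy T hVs.1 hBs.1 with hφ
  have hd : ∀ T, 0 ≤ T → HasDerivAt φ (∑ x, p x * quasiEntropy T (hV x).1 (hB x).1 -
      quasiEntropy T hVs.1 hBs.1) T := fun T hT => by
    refine HasDerivAt.sub (HasDerivAt.fun_sum fun x _ => ?_)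
      (hasDerivAt_integratedEntropy hVs hBs hs hT)
    rcases eq_or_ne (p x) 0 with h0 | h0
    · simpa only [h0, zero_mul] using hasDerivAt_const T (0 : ℝ)
    · exact (hasDerivAt_integratedEntropy (hV x) (hB x) (h x h0) hT).const_mul _
  have hmono : MonotoneOn φ (Set.Ici 0) := by
    refine monotoneOn_of_deriv_nonneg (convex_Ici 0)
      (fun T hT => (hd T hT).continuousAt.continuousWithinAt)
      (fun T hT => ?_) fun T hT => ?_ <;> rw [interior_Ici] at hT
    · exact (hd T (le_of_lt hT)).differentiableAt.differentiableWithinAt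
    · rw [(hd T (le_of_lt hT)).deriv]
      exact sub_nonneg.2 (quasiEntropy_sum_le hT hp hV hB hVs hBs)
  have hnn : ∀ T, 0 ≤ T → 0 ≤ φ T := fun T hT => by
    have h0 : φ 0 = 0 := by simp [hφ, integratedEntropy_zero]
    rw [← h0]
    exact hmono (Set.mem_Ici.2 le_rfl) hT hT
  have hlim : Tendsto φ atTop (𝓝 (∑ x, p x * relEnt (V x) (B x) -
      relEnt (∑ x, p x • V x) (∑ x, p x • B x))) := by
    refine Tendsto.congr (fun T => ?_) ((tendsto_finsetSum Finset.univ fun x _ =>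
      (tendsto_integratedEntropy (hV x) (hB x)).const_mul (p x)).sub
      (tendsto_integratedEntropy hVs hBs))
    simp only [hφ, mul_sub, Finset.sum_sub_distrib, Matrix.trace_sum, Matrix.trace_smul,
      Complex.re_sum, Complex.smul_re, smul_eq_mul, Finset.mul_sum]
    have : ∑ x, p x * (Real.log T * (V x).trace.re) = ∑ x, Real.log T * (p x * (V x).trace.re) :=
      Finset.sum_congr rfl fun x _ => by ring
    rw [this]
    ring
  have := ge_of_tendsto hlim (eventually_ge_atTop 0 |>.mono hnn)
  linarith

end Spectral

/-! ### The bound on `E_0` and the comparison of exponents. -/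

section Exponents

theorem posSemidef_sum_smul {X m : Type*} [Fintype X] [Fintype m] {p : X → ℝ} (hp : ∀ x, 0 ≤ p x)
    {A : X → Matrix m m ℂ} (hA : ∀ x, (A x).PosSemidef) : (∑ x, p x • A x).PosSemidef :=
  Matrix.posSemidef_sum _ fun x _ => (hA x).smul (hp x)

/-- A vanishing sum of nonnegative quadratic forms vanishes termwise. -/
theorem mulVec_eq_zero_of_sum_smul_mulVec_eq_zero {X m : Type*} [Fintype X] [Fintype m]
    {p : X → ℝ} (hp : ∀ x, 0 ≤ p x) {A : X → Matrix m m ℂ} (hA : ∀ x, (A x).PosSemidef)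
    {v : m → ℂ} (hv : (∑ x, p x • A x) *ᵥ v = 0) {x : X} (hx : p x ≠ 0) : A x *ᵥ v = 0 := by
  have hpA : ∀ x, (p x • A x).PosSemidef := fun x => (hA x).smul (hp x)
  have h : ∑ x, star v ⬝ᵥ (p x • A x) *ᵥ v = 0 := by
    rw [← dotProduct_sum, ← Matrix.sum_mulVec, hv, dotProduct_zero]
  have h1 := (Finset.sum_eq_zero_iff_of_nonneg
    fun x _ => (hpA x).dotProduct_mulVec_nonneg v).1 h x (Finset.mem_univ x)
  have h2 := ((hpA x).dotProduct_mulVec_zero_iff v).1 h1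
  rw [Matrix.smul_mulVec] at h2
  exact (smul_eq_zero.1 h2).resolve_left hx

variable {X n : Type*} [Fintype X] [Fintype n] [DecidableEq n]

/-- `E_0(s, P) ≤ D(V‖W|P) + s D(V‖σ|P)` for every channel `V` and every state `σ`. -/
theorem neg_log_trace_mpow_le {p : X → ℝ} (hp : p ∈ stdSimplex ℝ X) {s : ℝ} (hs : 0 ≤ s)
    (W V : Channel X n) (σ : Density n) (hW : ∀ x, p x ≠ 0 → supp (V x).1 ≤ supp (W x).1)
    (hσ : ∀ x, p x ≠ 0 → supp (V x).1 ≤ supp σ.1) :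
    -Real.log (mpow (∑ x, p x • mpow (W x).1 (1 / (1 + s))) (1 + s)).trace.re ≤
      ∑ x, p x * relEnt (V x).1 (W x).1 + s * ∑ x, p x * relEnt (V x).1 σ.1 := by
  have hs1 : 1 + s ≠ 0 := by positivity
  have ha : 1 / (1 + s) ≠ 0 := by positivity
  have hV : ∀ x, (V x).1.PosSemidef := fun x => (V x).2.1
  have hB : ∀ x, (mpow (W x).1 (1 / (1 + s))).PosSemidef :=
    fun x => mpow_posSemidef (W x).2.1 ha
  have hVs := posSemidef_sum_smul hp.1 hV
  have hA := posSemidef_sum_smul hp.1 hB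
  have hVt : (∑ x, p x • (V x).1).trace = 1 := by
    have h1 : ∀ x, (V x).1.trace = 1 := fun x => (V x).2.2
    rw [Matrix.trace_sum]
    simp only [Matrix.trace_smul, h1]
    rw [← Finset.sum_smul, hp.2, one_smul]
  have kB : ∀ x, p x ≠ 0 → ∀ v, mpow (W x).1 (1 / (1 + s)) *ᵥ v = 0 → (V x).1 *ᵥ v = 0 :=
    fun x hx v hv => mulVec_eq_zero_of_supp_le (hV x).1 (W x).2.1.1 (hW x hx)
      (mulVec_eq_zero_of_mpow_mulVec_eq_zero (W x).2.1 ha hv)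
  have kVs : ∀ v, (∀ x, p x ≠ 0 → (V x).1 *ᵥ v = 0) → (∑ x, p x • (V x).1) *ᵥ v = 0 :=
    fun v h => by
      rw [Matrix.sum_mulVec]
      refine Finset.sum_eq_zero fun x _ => ?_
      rw [Matrix.smul_mulVec]
      rcases eq_or_ne (p x) 0 with h0 | h0
      · rw [h0, zero_smul]
      · rw [h x h0, smul_zero]
  have kA : ∀ v, (∑ x, p x • mpow (W x).1 (1 / (1 + s))) *ᵥ v = 0 →
      (∑ x, p x • (V x).1) *ᵥ v = 0 := fun v hv => kVs v fun x hx =>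
    kB x hx v (mulVec_eq_zero_of_sum_smul_mulVec_eq_zero hp.1 hB hv hx)
  have convexity := relEnt_sum_le hp.1 hV hB hVs hA kB kA
  have gibbs := neg_log_trace_le_relEnt hVs hVt (mpow_posSemidef hA hs1) fun v hv =>
    kA v (mulVec_eq_zero_of_mpow_mulVec_eq_zero hA hs1 hv)
  -- This is `D(V̄‖σ) ≥ 0`, as `σ` has unit trace.
  have klein := neg_log_trace_le_relEnt hVs hVt σ.2.1 fun v hv =>
    kVs v fun x hx => mulVec_eq_zero_of_supp_le (hV x).1 σ.2.1.1 (hσ x hx) hv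
  rw [σ.2.2, Complex.one_re, Real.log_one, neg_zero] at klein
  have hlin : ((∑ x, p x • (V x).1) * mlog σ.1).trace.re =
      ∑ x, p x * ((V x).1 * mlog σ.1).trace.re := by
    simp only [Finset.sum_mul, Matrix.trace_sum, smul_mul_assoc, Matrix.trace_smul,
      Complex.re_sum, Complex.smul_re, smul_eq_mul]
  have hBlog : ∀ x, ((V x).1 * mlog (mpow (W x).1 (1 / (1 + s)))).trace.re =
      1 / (1 + s) * ((V x).1 * mlog (W x).1).trace.re := fun x => by
    rw [mlog_mpow (W x).2.1 ha, mul_smul_comm, Matrix.trace_smul, Complex.smul_re, smul_eq_mul]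
  simp only [relEnt_eq_sub, mlog_mpow hA hs1, mul_smul_comm, Matrix.trace_smul, Complex.smul_re,
    smul_eq_mul, hlin, hBlog, mul_sub, Finset.sum_sub_distrib] at *
  have e : ∑ x, p x * (1 / (1 + s) * ((V x).1 * mlog (W x).1).trace.re) =
      1 / (1 + s) * ∑ x, p x * ((V x).1 * mlog (W x).1).trace.re := by
    rw [Finset.mul_sum]
    exact Finset.sum_congr rfl fun x _ => by ring
  rw [e] at convexity
  have h1 := mul_le_mul_of_nonneg_left convexity (show 0 ≤ 1 + s by positivity)
  have h2 := mul_nonneg hs klein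
  rw [mul_sub, mul_sub, ← mul_assoc (1 + s) (1 / (1 + s)), mul_one_div_cancel hs1, one_mul] at h1
  linarith

theorem relEntropy_of_supp_le {ρ σ : Matrix n n ℂ} (h : supp ρ ≤ supp σ) :
    relEntropy ρ σ = (relEnt ρ σ : EReal) := if_pos h

theorem relEntropy_nonneg (ρ σ : Density n) : 0 ≤ relEntropy ρ.1 σ.1 := by
  by_cases h : supp ρ.1 ≤ supp σ.1
  · rw [relEntropy_of_supp_le h]
    have := neg_log_trace_le_relEnt ρ.2.1 ρ.2.2 σ.2.1 fun v hv =>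
      mulVec_eq_zero_of_supp_le ρ.2.1.1 σ.2.1.1 h hv
    rw [σ.2.2, Complex.one_re, Real.log_one, neg_zero] at this
    exact_mod_cast this
  · rw [relEntropy, if_neg h]
    exact le_top

/-- All summands are nonnegative, so one infinite summand of positive weight already makes the sum
infinite. -/
theorem supp_le_of_condRelEntropy_ne_top {p : X → ℝ} (hp : ∀ x, 0 ≤ p x) {V W : Channel X n}
    (h : condRelEntropy V W p ≠ ⊤) (x : X) (hx : p x ≠ 0) : supp (V x).1 ≤ supp (W x).1 := by
  by_contra hc
  refine h (top_le_iff.1 ?_)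
  have h1 : (p x : EReal) * relEntropy (V x).1 (W x).1 = ⊤ := by
    rw [relEntropy, if_neg hc]
    exact EReal.coe_mul_top_of_pos ((hp x).lt_of_ne hx.symm)
  rw [← h1, condRelEntropy]
  exact Finset.single_le_sum (f := fun x => (p x : EReal) * relEntropy (V x).1 (W x).1)
    (fun y _ => mul_nonneg (by exact_mod_cast hp y) (relEntropy_nonneg _ _)) (Finset.mem_univ x)

theorem condRelEntropy_eq_coe {p : X → ℝ} {V W : Channel X n}
    (h : ∀ x, p x ≠ 0 → supp (V x).1 ≤ supp (W x).1) :
    condRelEntropy V W p = ((∑ x, p x * relEnt (V x).1 (W x).1 : ℝ) : EReal) := by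
  have hcoe : ∀ f : X → ℝ, ((∑ x, f x : ℝ) : EReal) = ∑ x, (f x : EReal) := fun f =>
    map_sum (⟨⟨Real.toEReal, EReal.coe_zero⟩, EReal.coe_add⟩ : ℝ →+ EReal) f Finset.univ
  rw [condRelEntropy, hcoe]
  refine Finset.sum_congr rfl fun x _ => ?_
  rcases eq_or_ne (p x) 0 with h0 | h0
  · simp [h0]
  · rw [relEntropy_of_supp_le (h x h0), EReal.coe_mul]

/-- Every point of the strong exponent is a lower bound of the weak one. -/
theorem auxE0_sub_le_condRelEntropy {p : X → ℝ} (hp : p ∈ stdSimplex ℝ X) {s R : ℝ} (hs : 0 ≤ s)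
    (W V : Channel X n) (hI : mutualInfo p V ≤ (R : EReal)) :
    ((auxE0 W s p - s * R : ℝ) : EReal) ≤ condRelEntropy V W p := by
  by_cases hW : condRelEntropy V W p = ⊤
  · rw [hW]
    exact le_top
  have kW := supp_le_of_condRelEntropy_ne_top hp.1 hW
  rw [condRelEntropy_eq_coe kW, EReal.coe_le_coe_iff]
  refine le_of_forall_pos_le_add fun δ hδ => ?_
  -- Slack replaces attainment of the infimum over `σ`; the denominator `1 + s` keeps `s` times the
  -- slack below `δ`, including at `s = 0`.
  have hlt : mutualInfo p V < ((R + δ / (1 + s) : ℝ) : EReal) :=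
    hI.trans_lt (EReal.coe_lt_coe_iff.2 (lt_add_of_pos_right R (by positivity)))
  obtain ⟨σ, hσ⟩ := iInf_lt_iff.1 hlt
  have kσ := supp_le_of_condRelEntropy_ne_top hp.1 hσ.ne_top
  rw [condRelEntropy_eq_coe kσ, EReal.coe_lt_coe_iff] at hσ
  have h1 := neg_log_trace_mpow_le hp hs W V σ kW kσ
  have h2 := mul_le_mul_of_nonneg_left hσ.le hs
  have h3 : s * (δ / (1 + s)) ≤ δ := by
    rw [mul_div_assoc', div_le_iff₀ (by positivity)]
    nlinarith
  rw [auxE0]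
  linarith

end Exponents

end CQ

end

theorem corollary1 {X n : Type*} [Fintype X] [DecidableEq X] [Fintype n] [DecidableEq n]
    (W : CQ.Channel X n) (R : ℝ) (hR : CQ.rateInfty W < (R : EReal))
    (P : X → ℝ) (hP : P ∈ stdSimplex ℝ X) :
    CQ.strongExponent W R P ≤ CQ.weakExponent W R P := by
  exact iSup_le fun s => le_iInf fun V => CQ.auxE0_sub_le_condRelEntropy hP s.2 W V.1 V.2
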